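/- Let $p\neq q$ be prime numbers, $d\ge 0$ an integer and $V$ a finite set. An $\mathbb F_p$-labeled $d$-hypergraph on $V$ is a pair $G=(V,\lambda)$ with $\lambda:\mathcal P(V)\setminus\{\emptyset\}\to\mathbb F_p$ and $\lambda(e)=0$ whenever $|e|>d$; the sets $e$ with $\lambda(e)\ne 0$ are its edges. The symmetric group $\mathrm{Sym}(V)$ acts on such hypergraphs by $\pi(V,\lambda)=(V,{}^\pi\lambda)$ with ${}^\pi\lambda(e)=\lambda(\pi^{-1}(e))$, and $\mathrm{Aut}(G)$ denotes the stabilizer of $G$. For $r\in\mathbb F_p$ let $\mathbf b(G;r)$ be the elementary expression which at an input $x\in\{0,1\}^V$ takes the value $1\in\mathbb F_q$ if $\sum_{\emptyset\ne e\subseteq V}\lambda(e)\prod_{v\in e}x_v=r$ in $\mathbb F_p$, and $0\in\mathbb F_q$ otherwise. The symmetric closure of $\mathbf b(G;r)$ is the expression $\mathbf s(G;r)=\sum_{i=1}^k\mathbf b(\pi_iG;r)$, where $\pi_1,\dots,\pi_k$ is a transversal of the left cosets $\mathrm{Sym}(V)/\mathrm{Aut}(G)$ (the choice of the transversal does not matter).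 Two $\mathbb F_q$-linear combinations of elementary expressions are equivalent, written $\equiv$, if they take the same value in $\mathbb F_q$ at every $x\in\{0,1\}^V$. A set $C\subseteq V$ is fully symmetric in $G$ if $\lambda(e_1)=\lambda(e_2)$ for all nonempty $e_1,e_2\subseteq V$ with $|e_1|=|e_2|$ and $e_1\setminus C=e_2\setminus C$. The hypergraph $G$ is symmetry-purified with respect to $C$ if (1) $C$ is fully symmetric in $G$, (2) every edge of $G$ is contained in $C$ or in $V\setminus C$, and (3) every edge of $G$ contained in $V\setminus C$ has exactly one element. Let $\mathrm{SymP}(V,C)$ be the set of all $\mathbb F_p$-labeled $d$-hypergraphs on $V$ that are symmetry-purified with respect to $C$. **Lemma.** Let $G=(V,\lambda)$ be an $\mathbb F_p$-labeled $d$-hypergraph, let $u\in\mathbb F_p$, and let $C\subseteq V$ be an inclusion-maximal fully symmetric set of $G$ with $|C|>|V|/2$. Then there are constants $\beta_{H,r}\in\mathbb F_q$ such that $$\mathbf s(G;u)\equiv\sum_{H\in\mathrm{SymP}(V,C)}\ \sum_{r\in\mathbb F_p}\beta_{H,r}\,\mathbf s(H;r).$$ -/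

import Mathlib

open scoped Pointwise

/-- An `𝔽_p`-labeled `d`-hypergraph on the vertex set `V`: every nonempty subset of `V` gets a label
in `𝔽_p`, and subsets with more than `d` elements get the label `0`. The labeling is only meaningful
on nonempty subsets; it is stored as a function on all finite subsets, with the value `0` at `∅`. -/
@[ext]
structure DHypergraph (p d : ℕ) (V : Type*) where
  label : Finset V → ZMod p
  label_empty : label ∅ = 0
  label_eq_zero_of_lt : ∀ e : Finset V, d < e.card → label e = 0

namespace DHypergraph

variable {p d : ℕ} {V : Type*}

noncomputable instance [NeZero p] [Fintype V] : Fintype (DHypergraph p d V) :=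
  haveI : Finite (DHypergraph p d V) :=
    Finite.of_injective (fun G : DHypergraph p d V => G.label) fun _ _ h => DHypergraph.ext h
  Fintype.ofFinite _

/-- The action of `Sym(V)` on hypergraphs, `(π λ)(e) = λ(π⁻¹(e))`. -/
instance [DecidableEq V] : MulAction (Equiv.Perm V) (DHypergraph p d V) where
  smul π G :=
    { label := fun e => G.label (π⁻¹ • e)
      label_empty := by simpa using G.label_empty
      label_eq_zero_of_lt := fun e he => G.label_eq_zero_of_lt _ (by simpa using he) }
  one_smul G := DHypergraph.ext (funext fun e => show G.label ((1 : Equiv.Perm V)⁻¹ • e) = _ by simp)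
  mul_smul π σ G := DHypergraph.ext (funext fun e =>
    show G.label ((π * σ)⁻¹ • e) = G.label (σ⁻¹ • π⁻¹ • e) by rw [mul_inv_rev, mul_smul])

/-- The automorphism group of `G`: the permutations `π` of `V` with `π(G) = G`. -/
def aut [DecidableEq V] (G : DHypergraph p d V) : Subgroup (Equiv.Perm V) :=
  MulAction.stabilizer (Equiv.Perm V) G

/-- `C` is fully symmetric in `G`. -/
def FullySymmetric [Fintype V] [DecidableEq V] (G : DHypergraph p d V) (C : Finset V) : Prop :=
  ∀ e₁ e₂ : Finset V, e₁.card = e₂.card → e₁ ∩ Cᶜ = e₂ ∩ Cᶜ → G.label e₁ = G.label e₂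

/-- `G` is symmetry-purified with respect to `C`. -/
structure SymmetryPurified [Fintype V] [DecidableEq V] (G : DHypergraph p d V) (C : Finset V) :
    Prop where
  fullySymmetric : G.FullySymmetric C
  subset_or_subset : ∀ e : Finset V, G.label e ≠ 0 → e ⊆ C ∨ e ⊆ Cᶜ
  card_eq_one : ∀ e : Finset V, G.label e ≠ 0 → e ⊆ Cᶜ → e.card = 1

open scoped Classical in
/-- The set of all `𝔽_p`-labeled `d`-hypergraphs on `V` that are symmetry-purified with respect
to `C`. -/
noncomputable def symP (p d : ℕ) [NeZero p] {V : Type*} [Fintype V] [DecidableEq V]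
    (C : Finset V) : Finset (DHypergraph p d V) :=
  Finset.univ.filter fun H => H.SymmetryPurified C

/-- The value in `𝔽_p` of the multilinear polynomial `∑_e λ(e) ∏_{v ∈ e} x_v` of `G` at a Boolean
input. -/
def polyVal [Fintype V] (G : DHypergraph p d V) (x : V → Bool) : ZMod p :=
  ∑ e : Finset V, G.label e * ∏ v ∈ e, (if x v then 1 else 0)

end DHypergraph

/-- Expressions `∑_{G, r} α_{G, r} b(G; r)` with coefficients in `𝔽_q`, as formal linear
combinations of the elementary expressions `b(G; r)`. -/
abbrev ModExpr (p q d : ℕ) (V : Type*) : Type _ :=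
  (DHypergraph p d V × ZMod p) →₀ ZMod q

namespace ModExpr

variable {p q d : ℕ} {V : Type*}

/-- The elementary expression `b(G; r)`. -/
noncomputable def b (q : ℕ) (G : DHypergraph p d V) (r : ZMod p) : ModExpr p q d V :=
  Finsupp.single (G, r) 1

/-- The value in `𝔽_q` of an expression at a Boolean input; `b(G; r)` takes the value `1` where the
polynomial of `G` has the value `r`, and `0` elsewhere. -/
noncomputable def eval [Fintype V] (f : ModExpr p q d V) (x : V → Bool) : ZMod q :=
  f.sum fun Gr α => α * (if Gr.1.polyVal x = Gr.2 then 1 else 0)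

/-- Two expressions are equivalent if they take the same value at every Boolean input. -/
def Equivalent [Fintype V] (f g : ModExpr p q d V) : Prop :=
  ∀ x : V → Bool, f.eval x = g.eval x

/-- The symmetric closure `s(G; r) = ∑_i b(π_i G; r)`, where `π_1, …, π_k` represent the left cosets
in `Sym(V) / Aut(G)`. (`MulAction.ofQuotientStabilizer _ G` sends the coset `π Aut(G)` to `π G`.) -/
noncomputable def s [Fintype V] [DecidableEq V] (q : ℕ) (G : DHypergraph p d V) (r : ZMod p) :
    ModExpr p q d V :=
  letI : Fintype (Equiv.Perm V ⧸ G.aut) := Fintype.ofFinite _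
  ∑ c : Equiv.Perm V ⧸ G.aut, b q (MulAction.ofQuotientStabilizer (Equiv.Perm V) G c) r

/-- `s(G; r)` is computed by any transversal of `Aut(G)` in `Sym(V)`. -/
theorem s_eq_sum_transversal [Fintype V] [DecidableEq V] (G : DHypergraph p d V) (r : ZMod p)
    (T : Finset (Equiv.Perm V)) (hT : Subgroup.IsComplement (T : Set (Equiv.Perm V)) G.aut) :
    s q G r = ∑ π ∈ T, b q (π • G) r := by
  let : Fintype (Equiv.Perm V ⧸ G.aut) := Fintype.ofFinite _
  rw [← Finset.sum_coe_sort T]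
  refine Fintype.sum_equiv hT.leftQuotientEquiv _ _ fun c => ?_
  have h : c = ((hT.leftQuotientEquiv c : Equiv.Perm V) : Equiv.Perm V ⧸ G.aut) :=
    (hT.quotientGroupMk_leftQuotientEquiv c).symm
  conv_lhs => rw [h]
  rfl

end ModExpr

namespace DHypergraph

variable {p d : ℕ} {V : Type*}

/-! Let `X` be the support of `x`. Once `z = X \ C` is known, the polynomial of `G` becomes a
polynomial `B` in the variables of `C` plus a constant `κ`. The test "`X \ C = z` and `B + κ = u`"
is a system of linear conditions over `𝔽_p`. It holds iff the homomorphism `(a, t) ↦ t (B + κ - u) +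
∑_{X \ C} a_v - ∑_z a_v` vanishes. Each value of this homomorphism compares a purified polynomial `t
B + ∑ a_v x_v` with a constant. The number of its zeros minus the number of points with value `1` is
`p ^ (|V| + 1)` or `0`, and `p` is invertible in `𝔽_q`. This makes `b(G; u)` a combination of
purified expressions (`evalLinear_purification`).

The construction is equivariant in `(G, C)`, so its sum over the orbit of `(G, C)` has coefficients
constant on orbits and is a combination of symmetric closures (`exists_eq_sum_s`). That sum
represents `s(G; u)` because automorphisms of `G` preserve `C` (`smul_eq_of_maximal`), so the orbits
of `(G, C)` and of `G` correspond. -/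

theorem smul_label [DecidableEq V] (π : Equiv.Perm V) (G : DHypergraph p d V) (e : Finset V) :
    (π • G).label e = G.label (π⁻¹ • e) := rfl

/-- The polynomial of `G` at `x` is the sum of the labels of the subsets of the support of `x`. -/
theorem polyVal_eq_sum_powerset [Fintype V] (G : DHypergraph p d V) (x : V → Bool) :
    G.polyVal x = ∑ e ∈ (Finset.univ.filter fun v => x v = true).powerset, G.label e := by
  classical
  have h : (Finset.univ.filter fun v => x v = true).powerset
      = Finset.univ.filter fun e : Finset V => ∀ v ∈ e, x v = true := by
    ext e; simp [Finset.subset_iff]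
  rw [h, Finset.sum_filter, polyVal]
  refine Finset.sum_congr rfl fun e _ => ?_
  rw [Finset.prod_boole]
  split_ifs <;> simp

variable [DecidableEq V]

/-! ### Fully symmetric sets and transpositions -/

section FullySymmetric

variable [Fintype V]

theorem FullySymmetric.smul {G : DHypergraph p d V} {C : Finset V} (h : G.FullySymmetric C)
    (π : Equiv.Perm V) : (π • G).FullySymmetric (π • C) := by
  intro e₁ e₂ hc hi
  refine h _ _ (by simpa using hc) ?_
  have hmem : ∀ e : Finset V, π⁻¹ • e ∩ Cᶜ = π⁻¹ • (e ∩ (π • C)ᶜ) := fun e => by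
    ext v
    simp only [Finset.mem_inter, Finset.mem_compl, Finset.mem_inv_smul_finset_iff,
      Finset.smul_mem_smul_finset_iff]
  rw [hmem, hmem, hi]

theorem FullySymmetric.swap_mem_aut {G : DHypergraph p d V} {C : Finset V}
    (h : G.FullySymmetric C) {a b : V} (ha : a ∈ C) (hb : b ∈ C) : Equiv.swap a b ∈ G.aut := by
  rw [aut, MulAction.mem_stabilizer_iff]
  ext e
  rw [smul_label, Equiv.swap_inv]
  refine h _ _ (by simp) ?_
  ext v
  simp only [Finset.mem_inter, Finset.mem_compl, and_congr_left_iff]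
  intro hv
  rw [← Equiv.swap_inv, Finset.mem_inv_smul_finset_iff, Equiv.Perm.smul_def,
    Equiv.swap_apply_of_ne_of_ne (by grind) (by grind)]

/-- Two sets of equal size that agree outside `C` are joined by exchanges of elements of `C`, each
exchange shrinking `e₁ \ e₂` by one. -/
theorem fullySymmetric_of_swap_mem_aut {G : DHypergraph p d V} {C : Finset V}
    (h : ∀ a ∈ C, ∀ b ∈ C, Equiv.swap a b ∈ G.aut) : G.FullySymmetric C := by
  intro e₁ e₂
  induction hn : (e₁ \ e₂).card generalizing e₁ with
  | zero =>
    intro hc _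
    rw [Finset.card_eq_zero, Finset.sdiff_eq_empty_iff_subset] at hn
    rw [Finset.eq_of_subset_of_card_le hn hc.ge]
  | succ n ih =>
    intro hc hi
    obtain ⟨a, ha⟩ : (e₁ \ e₂).Nonempty := Finset.card_pos.1 (by omega)
    obtain ⟨b, hb⟩ : (e₂ \ e₁).Nonempty :=
      Finset.card_pos.1 (by rw [← Finset.card_sdiff_comm hc]; omega)
    rw [Finset.mem_sdiff] at ha hb
    have haC : a ∈ C := by
      by_contra hn
      have : a ∈ e₁ ∩ Cᶜ := by simp [ha.1, hn]
      rw [hi] at this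
      exact ha.2 (Finset.mem_inter.1 this).1
    have hbC : b ∈ C := by
      by_contra hn
      have : b ∈ e₂ ∩ Cᶜ := by simp [hb.1, hn]
      rw [← hi] at this
      exact hb.2 (Finset.mem_inter.1 this).1
    have hs := h a haC b hbC
    rw [aut, MulAction.mem_stabilizer_iff] at hs
    have he : Equiv.swap a b • e₁ = insert b (e₁.erase a) := by
      ext v
      rw [← Equiv.swap_inv, Finset.mem_inv_smul_finset_iff, Equiv.Perm.smul_def,
        Equiv.swap_apply_def]
      clear ih h hn hc hi hs
      split_ifs <;> grind
    rw [← hs, smul_label, Equiv.swap_inv, hs]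
    refine ih _ ?_ (by simpa using hc) ?_
    · have : (Equiv.swap a b • e₁) \ e₂ = (e₁ \ e₂).erase a := by
        rw [he]; clear ih h hn hc hi hs; grind
      rw [this, Finset.card_erase_of_mem (by simp [ha])]
      omega
    · rw [← hi, he]; clear ih h hn hc hi hs; grind [Finset.mem_compl]

/-- Transpositions through a common element `c` of `C ∩ D` generate all transpositions of `C ∪ D`.
-/
theorem FullySymmetric.union {G : DHypergraph p d V} {C D : Finset V} (hC : G.FullySymmetric C)
    (hD : G.FullySymmetric D) (hCD : (C ∩ D).Nonempty) : G.FullySymmetric (C ∪ D) := by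
  obtain ⟨c, hc⟩ := hCD
  rw [Finset.mem_inter] at hc
  have key : ∀ a ∈ C ∪ D, Equiv.swap a c ∈ G.aut := fun a ha =>
    (Finset.mem_union.1 ha).elim (fun h => hC.swap_mem_aut h hc.1) fun h => hD.swap_mem_aut h hc.2
  refine fullySymmetric_of_swap_mem_aut fun a ha b hb => ?_
  exact SubmonoidClass.swap_mem_trans _ (key a ha) (Equiv.swap_comm b c ▸ key b hb)

/-- An automorphism of `G` preserves a maximal fully symmetric set with more than half of the
vertices. -/
theorem smul_eq_of_maximal {G : DHypergraph p d V} {C : Finset V}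
    (hC : Maximal G.FullySymmetric C) (hcard : Fintype.card V < 2 * C.card) {π : Equiv.Perm V}
    (hπ : π • G = G) : π • C = C := by
  have h : G.FullySymmetric (π • C) := by simpa only [hπ] using hC.1.smul π
  -- Two sets with more than half of the vertices must meet.
  have hne : (C ∩ π • C).Nonempty := by
    rw [← Finset.card_pos]
    have h1 := Finset.card_union_add_card_inter C (π • C)
    have h2 := Finset.card_le_univ (C ∪ π • C)
    rw [Finset.card_smul_finset] at h1
    omega
  have hle : π • C ⊆ C :=
    Finset.subset_union_right.trans (hC.2 (hC.1.union h hne) Finset.subset_union_left)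
  exact Finset.eq_of_subset_of_card_le hle (by simp)

end FullySymmetric

/-! ### Purified hypergraphs and their polynomials -/

/-- The hypergraph with the polynomial
`t * ∑_{∅ ≠ e ⊆ C} (∑_{S ⊆ z} λ(S ∪ e)) x^e + ∑_{v ∉ C} a_v x_v`. -/
def purified (hd : 0 < d) (G : DHypergraph p d V) (C z : Finset V) (a : V → ZMod p) (t : ZMod p) :
    DHypergraph p d V where
  label e := (if e ⊆ C ∧ e.Nonempty then t * ∑ S ∈ z.powerset, G.label (S ∪ e) else 0) +
    if e.card = 1 ∧ ¬ e ⊆ C then ∑ v ∈ e, a v else 0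
  label_empty := by simp
  label_eq_zero_of_lt e he := by
    rw [Finset.sum_eq_zero fun S _ => G.label_eq_zero_of_lt (S ∪ e)
      (he.trans_le (Finset.card_le_card Finset.subset_union_right)), mul_zero, ite_self,
      if_neg (by omega), add_zero]

theorem symmetryPurified_purified [Fintype V] (hd : 0 < d) {G : DHypergraph p d V}
    {C z : Finset V} (hC : G.FullySymmetric C) (hz : z ⊆ Cᶜ) (a : V → ZMod p) (t : ZMod p) :
    (purified hd G C z a t).SymmetryPurified C where
  fullySymmetric e₁ e₂ hc hi := by
    have hsub : ∀ e : Finset V, e ⊆ C ↔ e ∩ Cᶜ = ∅ := fun e => by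
      rw [← Finset.sdiff_eq_inter_compl, Finset.sdiff_eq_empty_iff_subset]
    have hiff : e₁ ⊆ C ↔ e₂ ⊆ C := by rw [hsub, hsub, hi]
    have hne : e₁.Nonempty ↔ e₂.Nonempty := by rw [← Finset.card_pos, ← Finset.card_pos, hc]
    simp only [purified, hiff, hne, hc]
    congr 1
    · split_ifs with h
      · congr 1
        refine Finset.sum_congr rfl fun S hS => hC _ _ ?_ ?_
        · have hd : ∀ e ⊆ C, Disjoint S e := fun e he =>
            (disjoint_compl_left (a := C)).mono ((Finset.mem_powerset.1 hS).trans hz) he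
          rw [Finset.card_union_of_disjoint (hd _ (hiff.2 h.1)),
            Finset.card_union_of_disjoint (hd _ h.1), hc]
        · rw [Finset.union_inter_distrib_right, Finset.union_inter_distrib_right, hi]
      · rfl
    · split_ifs with h
      · have : ∀ e : Finset V, e.card = 1 → ¬ e ⊆ C → e = e ∩ Cᶜ := by
          intro e h1 h2
          obtain ⟨v, rfl⟩ := Finset.card_eq_one.1 h1
          rw [Finset.singleton_subset_iff] at h2
          rw [Finset.inter_eq_left.2 (by simpa using h2)]
        rw [this e₁ (hc.trans h.1) (by rw [hiff]; exact h.2), this e₂ h.1 h.2, hi]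
      · rfl
  subset_or_subset e he := by
    by_contra! hn
    apply he
    have : e.card ≠ 1 := by
      intro h1
      obtain ⟨v, rfl⟩ := Finset.card_eq_one.1 h1
      simp at hn
    simp [purified, hn.1, this]
  card_eq_one e he hs := by
    by_contra hn
    apply he
    have : ¬ (e ⊆ C ∧ e.Nonempty) := by
      rintro ⟨h1, v, hv⟩
      exact Finset.mem_compl.1 (hs hv) (h1 hv)
    simp [purified, this, hn]

theorem smul_purified (hd : 0 < d) (π : Equiv.Perm V) (G : DHypergraph p d V) (C z : Finset V)
    (a : V → ZMod p) (t : ZMod p) :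
    π • purified hd G C z a t
      = purified hd (π • G) (π • C) (π • z) (fun v => a (π⁻¹ v)) t := by
  ext e
  have hsub : π⁻¹ • e ⊆ C ↔ e ⊆ π • C := by
    rw [← Finset.smul_finset_subset_smul_finset_iff (a := π), smul_inv_smul]
  simp only [smul_label, purified, hsub, Finset.card_smul_finset, Finset.smul_finset_nonempty]
  congr 1
  · refine if_congr Iff.rfl (congrArg (t * ·) ?_) rfl
    refine Finset.sum_nbij' (π • ·) (π⁻¹ • ·) ?_ ?_ ?_ ?_ ?_
    · intro S; simp
    · intro S
      simp only [Finset.mem_powerset]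
      exact Finset.subset_smul_finset_iff.1
    · simp
    · simp
    · intro S _
      rw [Finset.smul_finset_union, inv_smul_smul]
  · refine if_congr Iff.rfl ?_ rfl
    rw [Finset.smul_finset_def, Finset.sum_image (MulAction.injective π⁻¹).injOn]
    rfl

/-- The right-hand side for `purified`: `purified hd G C z a t` takes this value wherever `x`
restricts to the indicator of `z` outside `C` and the polynomial of `G` has the value `u`. -/
def purifiedValue (G : DHypergraph p d V) (z : Finset V) (a : V → ZMod p) (t u : ZMod p) : ZMod p :=
  t * (u - ∑ S ∈ z.powerset, G.label S) + ∑ v ∈ z, a v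

theorem purifiedValue_smul (π : Equiv.Perm V) (G : DHypergraph p d V) (z : Finset V)
    (a : V → ZMod p) (t u : ZMod p) :
    purifiedValue (π • G) (π • z) (fun v => a (π⁻¹ v)) t u = purifiedValue G z a t u := by
  unfold purifiedValue
  congr 1
  · congr 2
    refine Finset.sum_nbij' (π⁻¹ • ·) (π • ·) ?_ ?_ ?_ ?_ ?_
    · intro S
      simp only [Finset.mem_powerset]
      exact Finset.subset_smul_finset_iff.1
    · intro S; simp
    · simp
    · simp
    · intro S _; rfl
  · rw [Finset.smul_finset_def, Finset.sum_image (MulAction.injective π).injOn]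
    simp

theorem polyVal_purified [Fintype V] (hd : 0 < d) (G : DHypergraph p d V) (C z : Finset V)
    (a : V → ZMod p) (t : ZMod p) (x : V → Bool) :
    (purified hd G C z a t).polyVal x
      = t * (∑ e ∈ ((Finset.univ.filter fun v => x v = true) ∩ C).powerset.erase ∅,
          ∑ S ∈ z.powerset, G.label (S ∪ e))
        + ∑ v ∈ (Finset.univ.filter fun v => x v = true) \ C, a v := by
  rw [polyVal_eq_sum_powerset]
  generalize (Finset.univ.filter fun v => x v = true) = X
  simp only [purified, Finset.sum_add_distrib]
  congr 1
  · rw [← Finset.sum_filter, Finset.mul_sum]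
    refine Finset.sum_congr ?_ fun _ _ => rfl
    ext e
    simp only [Finset.mem_filter, Finset.mem_erase, Finset.mem_powerset, Finset.subset_inter_iff,
      Finset.nonempty_iff_ne_empty]
    tauto
  · rw [← Finset.sum_filter]
    symm
    refine Finset.sum_bij (fun v _ => {v}) ?_ ?_ ?_ ?_
    · intro v; simp
    · intro v _ w _; simp
    · intro e
      simp only [Finset.mem_filter, Finset.mem_powerset, Finset.card_eq_one]
      rintro ⟨h, ⟨v, rfl⟩, h'⟩
      exact ⟨v, Finset.mem_sdiff.2 (by simpa using And.intro h h'), rfl⟩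
    · simp

/-- Each subset of the support splits uniquely into a part in `C` and a part in `z`. The pairs with
empty part in `C` give the constant subtracted in `purifiedValue`. -/
theorem polyVal_eq_of_sdiff_eq [Fintype V] (G : DHypergraph p d V) {C z : Finset V} {x : V → Bool}
    (hz : (Finset.univ.filter fun v => x v = true) \ C = z) :
    G.polyVal x = (∑ e ∈ ((Finset.univ.filter fun v => x v = true) ∩ C).powerset.erase ∅,
          ∑ S ∈ z.powerset, G.label (S ∪ e)) + ∑ S ∈ z.powerset, G.label S := by
  rw [polyVal_eq_sum_powerset]
  revert hz
  generalize (Finset.univ.filter fun v => x v = true) = X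
  rintro rfl
  have h0 : ∑ S ∈ (X \ C).powerset, G.label S
      = ∑ S ∈ (X \ C).powerset, G.label (S ∪ ∅) := by simp
  rw [h0, Finset.sum_erase_add _ _ (Finset.empty_mem_powerset _), ← Finset.sum_product']
  refine Finset.sum_nbij' (fun e => (e ∩ C, e \ C)) (fun e => e.2 ∪ e.1) ?_ ?_ ?_ ?_ ?_
  all_goals simp only [Finset.mem_product, Finset.mem_powerset, Prod.forall, Prod.mk.injEq]
  · grind
  · grind
  · intro e _; grind
  · intro e f h; constructor <;> grind
  · intro e _; congr 1; grind

end DHypergraph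

/-! ### Detecting the zero homomorphism by counting -/

/-- Counting the zeros of an `𝔽_p`-valued homomorphism against its value `1` detects whether it
vanishes. -/
theorem sum_indicator_sub_indicator_eq {A R : Type*} [AddCommGroup A] [Fintype A] [Ring R] {p : ℕ}
    [Fact p.Prime] (φ : A →+ ZMod p) [Decidable (φ = 0)] :
    ∑ a, ((if φ a = 0 then 1 else 0) - (if φ a = 1 then 1 else 0) : R)
      = if φ = 0 then (Fintype.card A : R) else 0 := by
  split_ifs with h
  · simp [h]
  · obtain ⟨a, ha⟩ : ∃ a, φ a ≠ 0 := by
      by_contra! hn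
      exact h (AddMonoidHom.ext hn)
    have h1 : φ ((φ a)⁻¹.val • a) = 1 := by
      rw [map_nsmul, nsmul_eq_mul, ZMod.natCast_zmod_val, inv_mul_cancel₀ ha]
    -- Translation by an element of value `1` carries the fibre over `0` onto the fibre over `1`.
    rw [Finset.sum_sub_distrib, sub_eq_zero,
      ← Equiv.sum_comp (Equiv.addRight ((φ a)⁻¹.val • a)) fun b => if φ b = 1 then (1 : R) else 0]
    simp [h1]

/-! ### Symmetric closures as orbit sums -/

namespace ModExpr

open DHypergraph

variable {p q d : ℕ} {V : Type*} [Fintype V]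

/-- Evaluation at a Boolean input as a linear map. -/
noncomputable def evalLinear (x : V → Bool) : ModExpr p q d V →ₗ[ZMod q] ZMod q :=
  Finsupp.linearCombination (ZMod q) fun Gr => if Gr.1.polyVal x = Gr.2 then 1 else 0

theorem evalLinear_apply (x : V → Bool) (f : ModExpr p q d V) : evalLinear x f = f.eval x := rfl

theorem evalLinear_b (x : V → Bool) (G : DHypergraph p d V) (r : ZMod p) :
    evalLinear x (b q G r) = if G.polyVal x = r then 1 else 0 := by
  simp [evalLinear, b]

variable [DecidableEq V]

open scoped Classical in
theorem s_eq_sum_orbit [NeZero p] (G : DHypergraph p d V) (r : ZMod p) :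
    s q G r = ∑ H with H ∈ MulAction.orbit (Equiv.Perm V) G, b q H r := by
  let : Fintype (Equiv.Perm V ⧸ G.aut) := Fintype.ofFinite _
  rw [Finset.sum_subtype (p := fun H => H ∈ MulAction.orbit (Equiv.Perm V) G) _
    (fun H => by simp) fun H => b q H r]
  change ∑ c : Equiv.Perm V ⧸ G.aut,
    b q (MulAction.ofQuotientStabilizer (Equiv.Perm V) G c) r = _
  let f : Equiv.Perm V ⧸ G.aut ≃ MulAction.orbit (Equiv.Perm V) G :=
    (MulAction.orbitEquivQuotientStabilizer (Equiv.Perm V) G).symm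
  refine Fintype.sum_equiv f _ _ fun c => ?_
  induction c using QuotientGroup.induction_on with
  | H π => rfl

open scoped Classical in
theorem s_apply [NeZero p] (G H : DHypergraph p d V) (r t : ZMod p) :
    s q G r (H, t) = if H ∈ MulAction.orbit (Equiv.Perm V) G ∧ r = t then 1 else 0 := by
  rw [s_eq_sum_orbit, Finsupp.finsetSum_apply]
  simp only [b, Finsupp.single_apply, Prod.mk.injEq]
  by_cases hr : r = t <;> simp [hr]

/-- An expression whose coefficients are constant on the orbits of hypergraphs, and vanish on the
orbits that do not meet `P`, is a combination of symmetric closures of members of `P`. -/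
theorem exists_eq_sum_s [NeZero p] (F : ModExpr p q d V) (P : Finset (DHypergraph p d V))
    (hF : ∀ (π : Equiv.Perm V) H r, F (π • H, r) = F (H, r))
    (hP : ∀ H r, F (H, r) ≠ 0 → ∃ K ∈ P, K ∈ MulAction.orbit (Equiv.Perm V) H) :
    ∃ β : DHypergraph p d V → ZMod p → ZMod q,
      F = ∑ H ∈ P, ∑ r : ZMod p, β H r • s q H r := by
  classical
  let cls : DHypergraph p d V → MulAction.orbitRel.Quotient (Equiv.Perm V) (DHypergraph p d V) :=
    fun H => Quotient.mk'' H
  have hcls : ∀ H K, cls H = cls K ↔ H ∈ MulAction.orbit (Equiv.Perm V) K := fun H K =>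
    Quotient.eq''.trans MulAction.orbitRel_apply
  -- Members of `P` in one orbit have the same closure, so only one representative per orbit may
  -- carry the coefficient. The value `ω.out`, for orbits missing `P`, is a dummy.
  have hrep : ∃ rep : MulAction.orbitRel.Quotient (Equiv.Perm V) (DHypergraph p d V) →
      DHypergraph p d V, ∀ K ∈ P, rep (cls K) ∈ P ∧ cls (rep (cls K)) = cls K := by
    refine ⟨fun ω => if h : ∃ K ∈ P, cls K = ω then h.choose else ω.out, fun K hK => ?_⟩
    have h : ∃ L ∈ P, cls L = cls K := ⟨K, hK, rfl⟩
    simpa only [dif_pos h] using h.choose_spec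
  obtain ⟨rep, hrep⟩ := hrep
  refine ⟨fun H r => if rep (cls H) = H then F (H, r) else 0, ?_⟩
  ext ⟨H, t⟩
  simp only [Finsupp.finsetSum_apply, Finsupp.smul_apply, s_apply, smul_eq_mul, ← hcls]
  have h1 : ∀ K ∈ P, ∑ r : ZMod p, (if rep (cls K) = K then F (K, r) else 0) *
      (if cls H = cls K ∧ r = t then 1 else 0)
      = if K = rep (cls H) ∧ cls H = cls K then F (K, t) else 0 := by
    intro K _
    rw [Finset.sum_eq_single t (by intro r _ hr; simp [hr]) (by simp)]
    by_cases h : cls H = cls K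
    · simp [h, eq_comm]
    · simp [h]
  rw [Finset.sum_congr rfl h1]
  by_cases hH : ∃ K ∈ P, cls K = cls H
  · obtain ⟨K, hK, hKH⟩ := hH
    obtain ⟨h2, h3⟩ := hrep K hK
    rw [hKH] at h2 h3
    rw [Finset.sum_eq_single_of_mem _ h2 (by intro L _ hL; simp [hL]), if_pos ⟨rfl, h3.symm⟩]
    obtain ⟨π, hπ⟩ := (hcls _ _).1 h3
    rw [← hπ]
    exact (hF π H t).symm
  · rw [Finset.sum_eq_zero]
    · by_contra hne
      obtain ⟨K, hK, hKH⟩ := hP H t hne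
      exact hH ⟨K, hK, (hcls _ _).2 hKH⟩
    · intro K hK
      exact if_neg fun h => hH ⟨K, hK, h.2.symm⟩

/-! ### The equivariant purification of an elementary expression -/

/-- A combination of elementary expressions of the hypergraphs `purified hd G C z a t`, equivalent
to `b(G; u)` and depending equivariantly on `G` and `C`. -/
noncomputable def purification [NeZero p] (q : ℕ) (hd : 0 < d) (G : DHypergraph p d V)
    (C : Finset V) (u : ZMod p) : ModExpr p q d V :=
  ((p : ZMod q) ^ (Fintype.card V + 1))⁻¹ • ∑ z ∈ Cᶜ.powerset, ∑ w : (V → ZMod p) × ZMod p,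
    (b q (purified hd G C z w.1 w.2) (purifiedValue G z w.1 w.2 u) -
      b q (purified hd G C z w.1 w.2) (purifiedValue G z w.1 w.2 u + 1))

theorem evalLinear_purification [Fact p.Prime] [Fact q.Prime] (hpq : p ≠ q) (hd : 0 < d)
    (G : DHypergraph p d V) (C : Finset V) (u : ZMod p) (x : V → Bool) :
    evalLinear x (purification q hd G C u) = if G.polyVal x = u then 1 else 0 := by
  classical
  have hp : (p : ZMod q) ≠ 0 := by
    rw [Ne, ZMod.natCast_eq_zero_iff, Nat.prime_dvd_prime_iff_eq Fact.out Fact.out]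
    exact hpq.symm
  simp only [purification, map_smul, map_sum, map_sub, evalLinear_b]
  set X := Finset.univ.filter fun v => x v = true with hX
  have key : ∀ z ∈ Cᶜ.powerset, ∑ w : (V → ZMod p) × ZMod p,
      ((if (purified hd G C z w.1 w.2).polyVal x = purifiedValue G z w.1 w.2 u
        then 1 else 0) -
      (if (purified hd G C z w.1 w.2).polyVal x = purifiedValue G z w.1 w.2 u + 1
        then 1 else 0) : ZMod q)
      = if X \ C = z then if G.polyVal x = u then (p : ZMod q) ^ (Fintype.card V + 1) else 0
        else 0 := by
    intro z _
    set B := ∑ e ∈ (X ∩ C).powerset.erase ∅, ∑ S ∈ z.powerset, G.label (S ∪ e) with hB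
    set κ := ∑ S ∈ z.powerset, G.label S with hκ
    let φ : (V → ZMod p) × ZMod p →+ ZMod p :=
      { toFun := fun w => w.2 * (B + κ - u) + (∑ v ∈ X \ C, w.1 v - ∑ v ∈ z, w.1 v)
        map_zero' := by simp
        map_add' := fun f g => by
          simp only [Prod.snd_add, Prod.fst_add, Pi.add_apply, Finset.sum_add_distrib]
          ring }
    have hval : ∀ (w : (V → ZMod p) × ZMod p) (c : ZMod p),
        (purified hd G C z w.1 w.2).polyVal x = purifiedValue G z w.1 w.2 u + c ↔
          φ w = c := by
      intro w c
      rw [polyVal_purified, purifiedValue, ← hX, ← hB, ← hκ]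
      change _ ↔ w.2 * (B + κ - u) + (∑ v ∈ X \ C, w.1 v - ∑ v ∈ z, w.1 v) = c
      constructor <;> intro h <;> linear_combination h
    have hval0 := fun w => hval w 0
    simp only [add_zero] at hval0
    simp only [hval0, hval]
    rw [sum_indicator_sub_indicator_eq φ, ← ite_and]
    have hcard : (Fintype.card ((V → ZMod p) × ZMod p) : ZMod q) = p ^ (Fintype.card V + 1) := by
      simp [ZMod.card, pow_succ]
    rw [hcard]
    refine if_congr ?_ rfl rfl
    constructor
    · intro h
      -- Evaluating `φ` at the unit vector of `v` compares membership of `v` in `X \ C` and in `z`;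
      -- evaluating at `(0, 1)` below isolates `B + κ - u`.
      have hz : X \ C = z := by
        ext v
        have h1 : φ (Pi.single v 1, 0) = 0 := by rw [h]; rfl
        change 0 * _ + (∑ i ∈ X \ C, (Pi.single v 1 : V → ZMod p) i
          - ∑ i ∈ z, (Pi.single v 1 : V → ZMod p) i) = 0 at h1
        rw [Finset.sum_pi_single', Finset.sum_pi_single'] at h1
        by_cases h2 : v ∈ X \ C <;> by_cases h3 : v ∈ z <;> simp [h2, h3] at h1 ⊢
      refine ⟨hz, ?_⟩
      have h1 : φ (0, 1) = 0 := by rw [h]; rfl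
      have h2 : φ (0, 1) = B + κ - u := by simp [φ]
      rw [polyVal_eq_of_sdiff_eq G hz, ← hX, ← hB, ← hκ]
      exact sub_eq_zero.1 (h2 ▸ h1)
    · rintro ⟨hz, hu⟩
      rw [polyVal_eq_of_sdiff_eq G hz, ← hX, ← hB, ← hκ] at hu
      refine AddMonoidHom.ext fun w => ?_
      simp [φ, hz, hu]
  rw [Finset.sum_congr rfl key, Finset.sum_ite_eq, if_pos]
  · split_ifs
    · rw [smul_eq_mul, inv_mul_cancel₀ (pow_ne_zero _ hp)]
    · simp
  · rw [Finset.mem_powerset, Finset.sdiff_eq_inter_compl]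
    exact Finset.inter_subset_right

theorem purification_smul [NeZero p] (hd : 0 < d) (G : DHypergraph p d V) (C : Finset V)
    (u : ZMod p) (π : Equiv.Perm V) :
    purification q hd (π • G) (π • C) u
      = Finsupp.lmapDomain (ZMod q) (ZMod q) (Prod.map (π • ·) id) (purification q hd G C u) := by
  have hb : ∀ (H : DHypergraph p d V) (r : ZMod p),
      Finsupp.lmapDomain (ZMod q) (ZMod q) (Prod.map (π • ·) id) (b q H r) = b q (π • H) r := by
    intro H r
    simp [b, Finsupp.mapDomain_single]
  simp only [purification, map_smul, map_sum, map_sub, hb]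
  congr 1
  symm
  have hcompl : ∀ z : Finset V, π • z ⊆ (π • C)ᶜ ↔ z ⊆ Cᶜ := fun z => by
    rw [Finset.subset_compl_iff_disjoint_right, Finset.subset_compl_iff_disjoint_right,
      Finset.smul_finset_def, Finset.smul_finset_def, Finset.disjoint_image (MulAction.injective π)]
  refine Finset.sum_equiv (MulAction.toPerm π) (fun z => ?_) fun z _ => ?_
  · rw [Finset.mem_powerset, Finset.mem_powerset]
    exact (hcompl z).symm
  -- The coefficient vector `a` is transported to `a ∘ π⁻¹`, while `t` stays fixed.
  · refine Fintype.sum_equiv ((Equiv.arrowCongr π (Equiv.refl _)).prodCongr (Equiv.refl _)) _ _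
      fun w => ?_
    have h1 := smul_purified hd π G C z w.1 w.2
    have h2 := purifiedValue_smul π G z w.1 w.2 u
    rw [h1, ← h2]
    rfl

theorem purification_smul_apply [NeZero p] (hd : 0 < d) (G : DHypergraph p d V) (C : Finset V)
    (u : ZMod p) (π : Equiv.Perm V) (H : DHypergraph p d V) (r : ZMod p) :
    purification q hd (π • G) (π • C) u (π • H, r) = purification q hd G C u (H, r) := by
  rw [purification_smul]
  exact Finsupp.mapDomain_apply
    ((MulAction.injective π).prodMap Function.injective_id) _ (H, r)

theorem symmetryPurified_of_purification_ne_zero [NeZero p] (hd : 0 < d) {G : DHypergraph p d V}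
    {C : Finset V} (hC : G.FullySymmetric C) {u : ZMod p} {H : DHypergraph p d V} {r : ZMod p}
    (h : purification q hd G C u (H, r) ≠ 0) : H.SymmetryPurified C := by
  by_contra hH
  apply h
  have hne : ∀ z ∈ Cᶜ.powerset, ∀ a t, purified hd G C z a t ≠ H := by
    rintro z hz a t rfl
    exact hH (symmetryPurified_purified hd hC (Finset.mem_powerset.1 hz) a t)
  rw [purification, Finsupp.smul_apply, Finsupp.finsetSum_apply, Finset.sum_eq_zero, smul_zero]
  intro z hz
  rw [Finsupp.finsetSum_apply]
  exact Finset.sum_eq_zero fun w _ => by simp [b, hne z hz]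

end ModExpr

/-! ### Summation over the orbit of `(G, C)` -/

theorem mainTheorem6 {p q : ℕ} [Fact p.Prime] [Fact q.Prime] (hpq : p ≠ q) {d : ℕ}
    {V : Type*} [Fintype V] [DecidableEq V] (G : DHypergraph p d V) (u : ZMod p)
    (C : Finset V) (hC : Maximal G.FullySymmetric C)
    (hcard : (Fintype.card V : ℚ) / 2 < C.card) :
    ∃ β : DHypergraph p d V → ZMod p → ZMod q,
      ModExpr.Equivalent (ModExpr.s q G u)
        (∑ H ∈ DHypergraph.symP p d C, ∑ r : ZMod p, β H r • ModExpr.s q H r) := by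
  classical
  have hcard' : Fintype.card V < 2 * C.card := by
    rw [div_lt_iff₀ two_pos] at hcard
    rw [mul_comm]
    exact_mod_cast hcard
  -- For `d = 0` the linear terms of `purified` are not allowed, but `G` has no edges and is itself
  -- purified.
  rcases Nat.eq_zero_or_pos d with rfl | hd
  · have hzero : ∀ e, G.label e = 0 := fun e => by
      rcases e.eq_empty_or_nonempty with rfl | he
      · exact G.label_empty
      · exact G.label_eq_zero_of_lt e he.card_pos
    have hG : G ∈ DHypergraph.symP p 0 C := by
      rw [DHypergraph.symP, Finset.mem_filter]
      exact ⟨Finset.mem_univ _, hC.1, fun e he => absurd (hzero e) he,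
        fun e he => absurd (hzero e) he⟩
    refine ⟨fun H r => if H = G ∧ r = u then 1 else 0, fun x => congrArg (ModExpr.eval · x) ?_⟩
    rw [Finset.sum_eq_single_of_mem G hG (by intro H _ hH; simp [hH]),
      Finset.sum_eq_single u (by intro r _ hr; simp [hr]) (by simp)]
    simp
  · let O : Finset (DHypergraph p d V × Finset V) :=
      Finset.univ.filter (· ∈ MulAction.orbit (Equiv.Perm V) (G, C))
    have hO : ∀ P, P ∈ O ↔ ∃ π : Equiv.Perm V, (π • G, π • C) = P := fun P => by
      simp [O, MulAction.mem_orbit_iff]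
    obtain ⟨β, hβ⟩ := ModExpr.exists_eq_sum_s
      (∑ P ∈ O, ModExpr.purification q hd P.1 P.2 u) (DHypergraph.symP p d C)
      (by
        intro π H r
        rw [Finsupp.finsetSum_apply, Finsupp.finsetSum_apply]
        symm
        refine Finset.sum_equiv (MulAction.toPerm π) (fun P => ?_) fun P _ => ?_
        · simp only [O, Finset.mem_filter, Finset.mem_univ, true_and, MulAction.toPerm_apply,
            ← MulAction.orbitRel_apply]
          rw [MulAction.orbitRel_apply, MulAction.orbitRel_apply, ← MulAction.orbit_eq_iff,
            ← MulAction.orbit_eq_iff, MulAction.orbit_smul]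
        · exact (ModExpr.purification_smul_apply hd P.1 P.2 u π H r).symm)
      (by
        intro H r hne
        rw [Finsupp.finsetSum_apply] at hne
        obtain ⟨P, hP, hne⟩ := Finset.exists_ne_zero_of_sum_ne_zero hne
        obtain ⟨π, rfl⟩ := (hO P).1 hP
        -- `H` is purified with respect to `π • C`; moving it back by `π⁻¹` gives `C`.
        refine ⟨π⁻¹ • H, ?_, MulAction.mem_orbit _ _⟩
        rw [← smul_inv_smul π H, ModExpr.purification_smul_apply] at hne
        rw [DHypergraph.symP, Finset.mem_filter]
        exact ⟨Finset.mem_univ _,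
          ModExpr.symmetryPurified_of_purification_ne_zero hd hC.1 hne⟩)
    refine ⟨β, fun x => ?_⟩
    rw [← hβ, ← ModExpr.evalLinear_apply, ← ModExpr.evalLinear_apply, ModExpr.s_eq_sum_orbit,
      map_sum, map_sum]
    simp only [ModExpr.evalLinear_b, ModExpr.evalLinear_purification hpq]
    symm
    refine Finset.sum_bij (fun P _ => P.1) ?_ ?_ ?_ fun _ _ => rfl
    · intro P hP
      obtain ⟨π, rfl⟩ := (hO P).1 hP
      simp
    -- Injectivity of `(π G, π C) ↦ π G` is where maximality and the size of `C` enter.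
    · intro P hP Q hQ h
      obtain ⟨π, rfl⟩ := (hO P).1 hP
      obtain ⟨σ, rfl⟩ := (hO Q).1 hQ
      have h1 : (σ⁻¹ * π) • G = G := by rw [mul_smul, inv_smul_eq_iff]; exact h
      have h2 := DHypergraph.smul_eq_of_maximal hC hcard' h1
      rw [mul_smul, inv_smul_eq_iff] at h2
      exact Prod.ext h h2
    · intro H hH
      obtain ⟨π, rfl⟩ := (Finset.mem_filter.1 hH).2
      exact ⟨(π • G, π • C), (hO _).2 ⟨π, rfl⟩, rfl⟩
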